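/- There is a universal constant $C>0$ such that the following holds. Let $d\ge 0$, $V\subset\mathbb R^d$, $n\ge 2$, and let $(X_1,Y_1),\dots,(X_n,Y_n)$ be i.i.d. with law $P$ on $\mathbb R^d\times\mathcal Y$ ($\mathcal Y$ a measurable space), with empirical distribution $P_n$. Let $\widehat C(x)=\{y\in\mathcal Y : s(x,y)\ge q(x)\}$, where the scoring function $s:\mathbb R^d\times\mathcal Y\to\mathbb R$ and the threshold function $q:\mathbb R^d\to\mathbb R$ are arbitrary (up to measurability) and may be random but are independent of the sample; below, $P(Y\in\widehat C(X)\mid\cdot)$ is taken with $\widehat C$ held fixed. Let $S_{v,a,b}=\{x\in\mathbb R^d : a\le v^Tx\le b\}$, and let $\mathrm{VC}(V)$ be the VC-dimension of the collection of halfspaces $\{x : v^Tx\le 0\}$, $v\in V$. Then $\mathrm{VC}(V)\le\min\{d,\log_2|V|\}$ (with the convention $\log_2|V|=0$ if $V=\emptyset$), and for all $0<\delta\le 1$ and all $t>0$, with probability at least $1-e^{-t}$, $$\sup_{v\in V,\ a\le b\,:\,P_n(X\in S_{v,a,b})\ge\delta}\bigl|P_n(Y\in\widehat C(X)\mid X\in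 S_{v,a,b})-P(Y\in\widehat C(X)\mid X\in S_{v,a,b})\bigr|\le C\sqrt{\frac{\max\{1,\mathrm{VC}(V)\}\log n+t}{\delta n}}\le C\sqrt{\frac{\max\{1,\min\{d,\log_2|V|\}\}\log n+t}{\delta n}} .$$ Here $P(Y\in\widehat C(X)\mid X\in S)$ is read as $0$ when $P(X\in S)=0$; if the event is not measurable, the claim is that its complement has outer probability at most $e^{-t}$. -/

import Mathlib

open MeasureTheory ProbabilityTheory

noncomputable section

/-- The family `F` of subsets of `α` shatters the finite set `A`: every subset of `A` is the trace
on `A` of a member of `F`. -/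
def ShattersSet {α : Type*} (F : Set (Set α)) (A : Finset α) : Prop :=
  ∀ B : Set α, B ⊆ (A : Set α) → ∃ S ∈ F, S ∩ (A : Set α) = B

/-- The VC-dimension of a family of sets: the supremum of the cardinalities of the finite sets that
it shatters (`⊤` if these are unbounded, `0` for the empty family). -/
def vcDimension {α : Type*} (F : Set (Set α)) : ℕ∞ :=
  ⨆ A : {A : Finset α // ShattersSet F A}, (A.1.card : ℕ∞)

/-- The collection of halfspaces `{x | vᵀ x ≤ 0}`, `v ∈ V`. -/
def halfspaces {d : ℕ} (V : Set (EuclideanSpace ℝ (Fin d))) :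
    Set (Set (EuclideanSpace ℝ (Fin d))) :=
  (fun v => {x | inner ℝ v x ≤ 0}) '' V

/-- `VC(V)`: the VC-dimension of the collection of halfspaces induced by `V`. -/
def VC {d : ℕ} (V : Set (EuclideanSpace ℝ (Fin d))) : ℕ∞ :=
  vcDimension (halfspaces V)

open Classical in
/-- `min {d, log₂ |V|}`, which is `d` if `V` is infinite. -/
def minDimLogCard {d : ℕ} (V : Set (EuclideanSpace ℝ (Fin d))) : ℝ :=
  if V.Finite then min (d : ℝ) (Real.logb 2 V.ncard) else d

/-- The slab `S_{v,a,b} = {x | a ≤ vᵀ x ≤ b}`. -/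
def slab {d : ℕ} (v : EuclideanSpace ℝ (Fin d)) (a b : ℝ) : Set (EuclideanSpace ℝ (Fin d)) :=
  {x | a ≤ inner ℝ v x ∧ inner ℝ v x ≤ b}

/-- The confidence set mapping of threshold form, `C(x) = {y | s(x, y) ≥ q(x)}`. -/
def thresholdSet {X Y : Type*} (s : X → Y → ℝ) (q : X → ℝ) (x : X) : Set Y :=
  {y | q x ≤ s x y}

/-- The empirical distribution of the sample `z 0, …, z (n - 1)`. -/
def empiricalDist {Z : Type*} [MeasurableSpace Z] {n : ℕ} (z : Fin n → Z) : Measure Z :=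
  (n : ENNReal)⁻¹ • ∑ i, Measure.dirac (z i)

/-- `Q(X ∈ S)` for a distribution `Q` of the pair `(X, Y)`. -/
def slabMass {X Y : Type*} [MeasurableSpace X] [MeasurableSpace Y] (Q : Measure (X × Y))
    (S : Set X) : ℝ :=
  Q.real {z | z.1 ∈ S}

/-- The conditional coverage `Q(Y ∈ C(X) | X ∈ S)` for a distribution `Q` of the pair `(X, Y)`,
with value `0` if `Q(X ∈ S) = 0`. -/
def condCoverage {X Y : Type*} [MeasurableSpace X] [MeasurableSpace Y] (Q : Measure (X × Y))
    (C : X → Set Y) (S : Set X) : ℝ :=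
  (ProbabilityTheory.cond Q {z | z.1 ∈ S}).real {z | z.2 ∈ C z.1}

end

/-!
The points of a finite sample that lie in a slab with direction `v` are those between the lowest
and the highest of them in direction `v`, so the traces of the slabs are determined by two sample
points and the traces of the halfspaces on the differences of sample points. By Sauer–Shelah there
are only polynomially many of them, with an exponent linear in the VC dimension.

Comparing with a ghost sample and swapping the members of the pairs at random, Hoeffding's
inequality and a union bound over the traces show that `|√(n P(S)) - √(n Pₙ(S))|` is at most some
`ρ = O(√(max(1, VC) log n + t))`, simultaneously for all slabs and for their covered parts, except
with probability `exp (-t)`. The square root stabilises the variance: the conditional coverage is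
a ratio of two masses, and the ratio then deviates by at most `4 ρ / √(n Pₙ(S))`, which gives the
rate `1 / √(δ n)` instead of the rate `1 / (δ √n)` that additive deviation bounds would give.
-/

open Filter Topology

theorem vcDimension_le {α : Type*} {F : Set (Set α)} {m : ℕ∞}
    (h : ∀ A : Finset α, ShattersSet F A → (A.card : ℕ∞) ≤ m) : vcDimension F ≤ m :=
  iSup_le fun A => h A.1 A.2

theorem ShattersSet.card_le_vcDimension {α : Type*} {F : Set (Set α)} {A : Finset α}
    (h : ShattersSet F A) : (A.card : ℕ∞) ≤ vcDimension F :=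
  le_iSup (fun A : {A : Finset α // ShattersSet F A} => (A.1.card : ℕ∞)) ⟨A, h⟩

theorem ShattersSet.two_pow_card_le_ncard {α : Type*} {F : Set (Set α)} {A : Finset α}
    (h : ShattersSet F A) (hF : F.Finite) : 2 ^ A.card ≤ F.ncard := by
  have powerset_subset : 𝒫 (A : Set α) ⊆ (· ∩ (A : Set α)) '' F := fun B hB => h B hB
  calc 2 ^ A.card = (𝒫 (A : Set α)).ncard := by
        rw [Set.ncard_powerset _ A.finite_toSet, Set.ncard_coe_finset]
    _ ≤ ((· ∩ (A : Set α)) '' F).ncard := Set.ncard_le_ncard powerset_subset (hF.image _)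
    _ ≤ F.ncard := Set.ncard_image_le hF

theorem vcDimension_le_log_ncard {α : Type*} {F : Set (Set α)} (hF : F.Finite) :
    vcDimension F ≤ Nat.log 2 F.ncard :=
  vcDimension_le fun _ hA => by
    exact_mod_cast Nat.le_log_of_pow_le one_lt_two (hA.two_pow_card_le_ncard hF)

section Halfspaces

variable {𝕜 E : Type*} [Field 𝕜] [LinearOrder 𝕜] [IsStrictOrderedRing 𝕜] [AddCommGroup E]
  [Module 𝕜 E]

/-- If a halfspace `{x | f x ≤ 0}` cut out exactly the points of nonpositive coefficient, every
term of `∑ c x * f x = 0` would be nonnegative, and strictly positive where `c x > 0`. -/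
theorem ShattersSet.nonpos_of_sum_smul_eq_zero {W : Set (Module.Dual 𝕜 E)} {A : Finset E}
    (h : ShattersSet ((fun f => {x | f x ≤ 0}) '' W) A) {c : E → 𝕜}
    (hc : ∑ x ∈ A, c x • x = 0) {x : E} (hx : x ∈ A) : c x ≤ 0 := by
  by_contra! hcx
  obtain ⟨_, ⟨f, -, rfl⟩, htrace⟩ := h {y | y ∈ A ∧ c y ≤ 0} fun y hy => hy.1
  have sign_iff : ∀ y ∈ A, (f y ≤ 0 ↔ c y ≤ 0) := fun y hy => by
    simpa [hy] using Set.ext_iff.1 htrace y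
  have sum_eq_zero : ∑ y ∈ A, c y * f y = 0 := by
    simpa only [map_sum, map_smul, smul_eq_mul, map_zero] using congrArg f hc
  refine (Finset.sum_pos' (fun y hy => ?_) ⟨x, hx, ?_⟩).ne' sum_eq_zero
  · rcases le_or_gt (c y) 0 with hy' | hy'
    · exact mul_nonneg_of_nonpos_of_nonpos hy' ((sign_iff y hy).2 hy')
    · exact mul_nonneg hy'.le (not_le.1 fun hf => hy'.not_ge ((sign_iff y hy).1 hf)).le
  · exact mul_pos hcx (not_le.1 fun hf => hcx.not_ge ((sign_iff x hx).1 hf))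

theorem vcDimension_dual_halfspaces_le_finrank [Module.Finite 𝕜 E] (W : Set (Module.Dual 𝕜 E)) :
    vcDimension ((fun f => {x | f x ≤ 0}) '' W) ≤ Module.finrank 𝕜 E := by
  refine vcDimension_le fun A hA => ?_
  by_contra! hlt
  obtain ⟨c, hc, x, hx, hcx⟩ :=
    Module.exists_nontrivial_relation_of_finrank_lt_card (Nat.cast_lt.1 hlt)
  have hneg : ∑ y ∈ A, (-c) y • y = 0 := by simp [hc]
  exact hcx (le_antisymm (hA.nonpos_of_sum_smul_eq_zero hc hx)
    (neg_nonpos.1 (hA.nonpos_of_sum_smul_eq_zero hneg hx)))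

end Halfspaces

theorem VC_le_dim {d : ℕ} (V : Set (EuclideanSpace ℝ (Fin d))) : VC V ≤ (d : ℕ∞) := by
  have h := vcDimension_dual_halfspaces_le_finrank (innerₗ (EuclideanSpace ℝ (Fin d)) '' V)
  rwa [Set.image_image, finrank_euclideanSpace_fin] at h

theorem natCast_toNat_VC {d : ℕ} (V : Set (EuclideanSpace ℝ (Fin d))) :
    (((VC V).toNat : ℕ) : ℕ∞) = VC V :=
  ENat.natCast_toNat ((VC_le_dim V).trans_lt (ENat.natCast_lt_top d)).ne

theorem toNat_VC_le_minDimLogCard {d : ℕ} (V : Set (EuclideanSpace ℝ (Fin d))) :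
    ((VC V).toNat : ℝ) ≤ minDimLogCard V := by
  have le_dim : ((VC V).toNat : ℝ) ≤ d := by
    exact_mod_cast ENat.toNat_le_of_le_natCast (VC_le_dim V)
  unfold minDimLogCard
  split_ifs with hV
  · refine le_min le_dim ?_
    calc ((VC V).toNat : ℝ) ≤ (Nat.log 2 (halfspaces V).ncard : ℕ) := by
          exact_mod_cast ENat.toNat_le_of_le_natCast (vcDimension_le_log_ncard (hV.image _))
      _ ≤ (Nat.log 2 V.ncard : ℕ) := by
          exact_mod_cast Nat.log_mono_right (Set.ncard_image_le hV)
      _ ≤ Real.logb 2 V.ncard := by exact_mod_cast Real.natLog_le_logb V.ncard 2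
  · exact le_dim

theorem sum_choose_le_succ_pow (m v : ℕ) : ∑ k ∈ Finset.Iic v, m.choose k ≤ (m + 1) ^ v := by
  rw [← Nat.range_succ_eq_Iic, add_pow]
  refine Finset.sum_le_sum fun k hk => ?_
  calc m.choose k ≤ m ^ k := Nat.choose_le_pow _ _
    _ ≤ m ^ k * 1 ^ (v - k) * v.choose k := by
        simpa using Nat.le_mul_of_pos_right _ (Nat.choose_pos (Finset.mem_range_succ_iff.1 hk))

theorem ncard_le_of_vcDimension_le {ι : Type*} [Fintype ι] {F : Set (Set ι)} {m : ℕ}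
    (hF : vcDimension F ≤ m) : F.ncard ≤ (Fintype.card ι + 1) ^ m := by
  classical
  set 𝒜 : Finset (Finset ι) := F.toFinset.map Fintype.finsetEquivSet.symm.toEmbedding
  have mem_𝒜 (S : Finset ι) : S ∈ 𝒜 ↔ (S : Set ι) ∈ F := by simp [𝒜]
  have vcDim_le : 𝒜.vcDim ≤ m := by
    refine Finset.sup_le fun A hA => ?_
    have hAF : ShattersSet F A := fun B hB => by
      obtain ⟨S, hS, hAS⟩ := Finset.mem_shatterer.1 hA (t := B.toFinset) (by simpa using hB)
      refine ⟨S, (mem_𝒜 S).1 hS, ?_⟩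
      rw [Set.inter_comm, ← Finset.coe_inter, hAS, Set.coe_toFinset]
    exact_mod_cast hAF.card_le_vcDimension.trans hF
  calc F.ncard = 𝒜.card := by rw [Finset.card_map, Set.ncard_eq_toFinset_card']
    _ ≤ 𝒜.shatterer.card := Finset.card_le_card_shatterer _
    _ ≤ ∑ k ∈ Finset.Iic 𝒜.vcDim, (Fintype.card ι).choose k := Finset.card_shatterer_le_sum_vcDim
    _ ≤ (Fintype.card ι + 1) ^ 𝒜.vcDim := sum_choose_le_succ_pow _ _
    _ ≤ (Fintype.card ι + 1) ^ m := Nat.pow_le_pow_right (Nat.succ_pos _) vcDim_le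

theorem ShattersSet.injOn_of_preimage {α β : Type*} {F : Set (Set β)} {f : α → β} {A : Finset α}
    (h : ShattersSet (Set.preimage f '' F) A) : Set.InjOn f A := by
  intro x hx y hy hxy
  obtain ⟨_, ⟨S, -, rfl⟩, hS⟩ := h {x} (by simpa using hx)
  have hxS : x ∈ f ⁻¹' S ∩ A := hS ▸ Set.mem_singleton x
  have hyS : y ∈ f ⁻¹' S ∩ A := ⟨show f y ∈ S from hxy ▸ hxS.1, hy⟩
  exact (Set.mem_singleton_iff.1 (hS ▸ hyS)).symm

theorem ShattersSet.image_of_preimage {α β : Type*} [DecidableEq β] {F : Set (Set β)} {f : α → β}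
    {A : Finset α} (h : ShattersSet (Set.preimage f '' F) A) : ShattersSet F (A.image f) := by
  intro B hB
  rw [Finset.coe_image] at hB ⊢
  obtain ⟨_, ⟨S, hSF, rfl⟩, hS⟩ := h (f ⁻¹' B ∩ A) Set.inter_subset_right
  refine ⟨S, hSF, ?_⟩
  rw [Set.inter_comm, ← Set.image_inter_preimage, Set.inter_comm, hS, Set.inter_comm,
    Set.image_inter_preimage, Set.inter_eq_right.2 hB]

theorem vcDimension_preimage_le {α β : Type*} (F : Set (Set β)) (f : α → β) :
    vcDimension (Set.preimage f '' F) ≤ vcDimension F := by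
  classical
  refine vcDimension_le fun A hA => ?_
  rw [← Finset.card_image_of_injOn hA.injOn_of_preimage]
  exact hA.image_of_preimage.card_le_vcDimension

theorem ncard_preimage_image_le_ncard_preimage_comp {Z X ι : Type*} [Finite ι] (F : Set (Set X))
    (f : Z → X) (A : Set Z) (y : ι → Z) :
    (Set.preimage y '' ((fun S => f ⁻¹' S ∩ A) '' F)).ncard
      ≤ (Set.preimage (f ∘ y) '' F).ncard := by
  have trace_inter : Set.preimage y '' ((fun S => f ⁻¹' S ∩ A) '' F)
      = (· ∩ y ⁻¹' A) '' (Set.preimage (f ∘ y) '' F) := by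
    simp only [Set.image_image]; rfl
  rw [trace_inter]
  exact Set.ncard_image_le (Set.toFinite _)

/-- The class of all slabs `S_{v,a,b}` with direction `v ∈ V`. -/
def slabs {d : ℕ} (V : Set (EuclideanSpace ℝ (Fin d))) : Set (Set (EuclideanSpace ℝ (Fin d))) :=
  {S | ∃ v ∈ V, ∃ a b : ℝ, S = slab v a b}

/-- A slab cuts out of finitely many points those between its lowest point `x i₀` and its highest
point `x i₁`, which a halfspace decides from the differences of the points. -/
theorem preimage_slab_eq_of_nonempty {d : ℕ} {ι : Type*} [Finite ι]
    (v : EuclideanSpace ℝ (Fin d)) (a b : ℝ) (x : ι → EuclideanSpace ℝ (Fin d))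
    (hne : (x ⁻¹' slab v a b).Nonempty) :
    ∃ i₀ i₁, x ⁻¹' slab v a b
      = {i | inner ℝ v (x i₀ - x i) ≤ 0 ∧ inner ℝ v (x i - x i₁) ≤ 0} := by
  obtain ⟨i₀, hi₀, hmin⟩ := Set.exists_min_image _ (fun i => inner ℝ v (x i)) (Set.toFinite _) hne
  obtain ⟨i₁, hi₁, hmax⟩ := Set.exists_max_image _ (fun i => inner ℝ v (x i)) (Set.toFinite _) hne
  refine ⟨i₀, i₁, Set.ext fun i => ?_⟩
  simp only [Set.mem_ofPred_eq, inner_sub_right, sub_nonpos]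
  exact ⟨fun hi => ⟨hmin i hi, hmax i hi⟩, fun hi => ⟨hi₀.1.trans hi.1, hi.2.trans hi₁.2⟩⟩

theorem ncard_preimage_slabs_le {d : ℕ} (V : Set (EuclideanSpace ℝ (Fin d))) {ι : Type*}
    [Fintype ι] (x : ι → EuclideanSpace ℝ (Fin d)) :
    (Set.preimage x '' slabs V).ncard ≤ (Fintype.card ι ^ 2 + 1) ^ ((VC V).toNat + 1) := by
  let 𝒟 : Set (Set (ι × ι)) := Set.preimage (fun k => x k.1 - x k.2) '' halfspaces V
  let between : Set (ι × ι) × (ι × ι) → Set ι := fun w =>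
    {i | (w.2.1, i) ∈ w.1 ∧ (i, w.2.2) ∈ w.1}
  have ncard_𝒟 : 𝒟.ncard ≤ (Fintype.card ι ^ 2 + 1) ^ (VC V).toNat := by
    rw [sq, ← Fintype.card_prod]
    refine ncard_le_of_vcDimension_le ((vcDimension_preimage_le _ _).trans ?_)
    rw [natCast_toNat_VC, VC]
  have traces_subset : Set.preimage x '' slabs V ⊆ insert ∅ (between '' (𝒟 ×ˢ Set.univ)) := by
    rintro _ ⟨_, ⟨v, hv, a, b, rfl⟩, rfl⟩
    rcases (x ⁻¹' slab v a b).eq_empty_or_nonempty with hempty | hne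
    · exact Or.inl hempty
    · obtain ⟨i₀, i₁, htrace⟩ := preimage_slab_eq_of_nonempty v a b x hne
      exact Or.inr ⟨(_, (i₀, i₁)), ⟨⟨_, ⟨v, hv, rfl⟩, rfl⟩, trivial⟩, htrace.symm⟩
  calc (Set.preimage x '' slabs V).ncard
      ≤ (insert ∅ (between '' (𝒟 ×ˢ Set.univ))).ncard :=
        Set.ncard_le_ncard traces_subset (Set.toFinite _)
    _ ≤ (between '' (𝒟 ×ˢ Set.univ)).ncard + 1 := Set.ncard_insert_le _ _
    _ ≤ (𝒟 ×ˢ (Set.univ : Set (ι × ι))).ncard + 1 := by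
        gcongr; exact Set.ncard_image_le (Set.toFinite _)
    _ = 𝒟.ncard * Fintype.card ι ^ 2 + 1 := by
        rw [Set.ncard_prod, Set.ncard_univ, Nat.card_eq_fintype_card, Fintype.card_prod, ← sq]
    _ ≤ (Fintype.card ι ^ 2 + 1) ^ (VC V).toNat * Fintype.card ι ^ 2
          + (Fintype.card ι ^ 2 + 1) ^ (VC V).toNat := by
        gcongr; exact Nat.one_le_pow _ _ (Nat.succ_pos _)
    _ = (Fintype.card ι ^ 2 + 1) ^ ((VC V).toNat + 1) := by ring

theorem measureReal_lt_abs_le_of_hasSubgaussianMGF {Ω : Type*} [MeasurableSpace Ω] {μ : Measure Ω}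
    [IsProbabilityMeasure μ] {X : Ω → ℝ} {c : NNReal} (hX : HasSubgaussianMGF X c μ) {r : ℝ}
    (hr : 0 ≤ r) : μ.real {ω | r * √c < |X ω|} ≤ 2 * Real.exp (-r ^ 2 / 2) := by
  rcases eq_zero_or_pos c with rfl | hc
  · have null : μ {ω | r * √(0 : NNReal) < |X ω|} = 0 := by
      refine measure_eq_zero_iff_ae_notMem.2 ?_
      filter_upwards [hX.ae_eq_zero_of_hasSubgaussianMGF_zero] with ω hω
      simp [hω]
    rw [measureReal_def, null, ENNReal.toReal_zero]
    positivity
  · have tail {W : Ω → ℝ} (hW : HasSubgaussianMGF W c μ) :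
        μ.real {ω | r * √c ≤ W ω} ≤ Real.exp (-r ^ 2 / 2) := by
      convert hW.measure_ge_le (ε := r * √c) (by positivity) using 2
      rw [mul_pow, Real.sq_sqrt c.coe_nonneg]
      field_simp
    calc μ.real {ω | r * √c < |X ω|}
        ≤ μ.real ({ω | r * √c ≤ X ω} ∪ {ω | r * √c ≤ (-X) ω}) :=
          measureReal_mono fun ω hω => (lt_abs.1 hω).imp le_of_lt fun h => le_of_lt (b := -X ω) h
      _ ≤ _ := measureReal_union_le _ _
      _ ≤ 2 * Real.exp (-r ^ 2 / 2) := by linarith [tail hX, tail hX.neg]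

/-- The law of a fair coin. An array of independent fair coins decides which of the pairs of a
double sample are swapped. -/
noncomputable def fairCoin : Measure Bool :=
  (PMF.uniformOfFintype Bool).toMeasure

instance : IsProbabilityMeasure fairCoin :=
  PMF.toMeasure.isProbabilityMeasure _

/-- The sign by which swapping (`true`) or not swapping a pair `(x, y)` multiplies `x - y`. -/
noncomputable def swapSign (b : Bool) : ℝ :=
  if b then -1 else 1

theorem hasSubgaussianMGF_swapSign : HasSubgaussianMGF swapSign 1 fairCoin := by
  have mem_Icc : ∀ b, swapSign b ∈ Set.Icc (-1 : ℝ) 1 := by rintro (_ | _) <;> simp [swapSign]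
  have mean_zero : ∫ b, swapSign b ∂fairCoin = 0 := by
    simp [fairCoin, PMF.integral_eq_sum, swapSign]
  have h := hasSubgaussianMGF_of_mem_Icc_of_integral_eq_zero
    (Measurable.of_discrete (f := swapSign)).aemeasurable (ae_of_all _ mem_Icc) mean_zero
  convert h
  ext
  norm_num

theorem measureReal_lt_abs_sum_mul_swapSign_le {ι : Type*} [Fintype ι] (c : ι → ℝ) {r : ℝ}
    (hr : 0 ≤ r) :
    (Measure.pi fun _ : ι => fairCoin).real
        {σ | r * √(∑ i, c i ^ 2) < |∑ i, c i * swapSign (σ i)|}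
      ≤ 2 * Real.exp (-r ^ 2 / 2) := by
  have indep : iIndepFun (fun i (σ : ι → Bool) => c i * swapSign (σ i))
      (Measure.pi fun _ => fairCoin) :=
    iIndepFun_pi (X := fun i b => c i * swapSign b) fun _ => Measurable.of_discrete.aemeasurable
  have subgaussian (i : ι) : HasSubgaussianMGF (fun σ : ι → Bool => c i * swapSign (σ i))
      (‖c i‖₊ ^ 2) (Measure.pi fun _ => fairCoin) := by
    refine HasSubgaussianMGF.of_map (Y := fun σ : ι → Bool => σ i)
      (X := fun b => c i * swapSign b) (measurable_pi_apply i).aemeasurable ?_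
    rw [(measurePreserving_eval (fun _ : ι => fairCoin) i).map_eq]
    convert hasSubgaussianMGF_swapSign.const_mul (c i)
    refine NNReal.eq (Eq.trans ?_ (mul_one (c i ^ 2)).symm)
    simp
  simpa using measureReal_lt_abs_le_of_hasSubgaussianMGF
    (HasSubgaussianMGF.sum_of_iIndepFun indep (s := Finset.univ) fun i _ => subgaussian i) hr

theorem abs_sqrt_sub_sqrt_le_two {m k : ℝ} (hm : 0 ≤ m) (hk : 0 ≤ k)
    (h : (k - m) ^ 2 ≤ 2 * m + 1) : |√m - √k| ≤ 2 := by
  by_contra! hlt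
  have le_sum : |√m - √k| ≤ √m + √k :=
    abs_le.2 ⟨by linarith [Real.sqrt_nonneg m], by linarith [Real.sqrt_nonneg k]⟩
  have factor : (k - m) ^ 2 = |√m - √k| ^ 2 * (√m + √k) ^ 2 := by
    nth_rw 1 [← Real.sq_sqrt hm, ← Real.sq_sqrt hk]
    rw [sq_abs]
    ring
  have dev_sq : 4 ≤ |√m - √k| ^ 2 := by nlinarith
  have le_sq_sum : m + 1 ≤ (√m + √k) ^ 2 := by
    nlinarith [Real.sq_sqrt hm, Real.sqrt_nonneg m, Real.sqrt_nonneg k]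
  nlinarith

/-- Taking square roots is variance stabilising: `|k - k'| = |√k - √k'| * (√k + √k')`, and
`√k + √k' ≥ √(k + k')`. -/
theorem mul_sqrt_add_lt_abs_sub {k k' r : ℝ} (hk : 0 ≤ k) (hk' : 0 ≤ k') (hr : 0 ≤ r)
    (h : r < |√k - √k'|) : r * √(k + k') < |k - k'| := by
  have sum_pos : 0 < √k + √k' := by
    by_contra! hle
    have hk0 : √k = 0 := by linarith [Real.sqrt_nonneg k, Real.sqrt_nonneg k']
    have hk0' : √k' = 0 := by linarith [Real.sqrt_nonneg k, Real.sqrt_nonneg k']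
    rw [hk0, hk0', sub_zero, abs_zero] at h
    exact hr.not_gt h
  calc r * √(k + k') ≤ r * (√k + √k') := by
        gcongr
        refine Real.sqrt_le_iff.2 ⟨sum_pos.le, ?_⟩
        nlinarith [Real.sq_sqrt hk, Real.sq_sqrt hk', Real.sqrt_nonneg k, Real.sqrt_nonneg k']
    _ < |√k - √k'| * (√k + √k') := by gcongr
    _ = |k - k'| := by
        rw [← abs_of_pos sum_pos, ← abs_mul, mul_comm, ← sq_sub_sq, Real.sq_sqrt hk,
          Real.sq_sqrt hk']

section Counts

variable {Z ι : Type*} [Fintype ι]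

/-- The number of sample points `z i` that fall in `S`, as a real number. -/
noncomputable def hitCount (S : Set Z) (z : ι → Z) : ℝ :=
  ∑ i, S.indicator 1 (z i)

theorem hitCount_nonneg (S : Set Z) (z : ι → Z) : 0 ≤ hitCount S z :=
  Finset.sum_nonneg fun _ _ => Set.indicator_nonneg (fun _ _ => zero_le_one) _

theorem hitCount_congr {S S' : Set Z} {z : ι → Z} (h : ∀ i, z i ∈ S ↔ z i ∈ S') :
    hitCount S z = hitCount S' z :=
  Finset.sum_congr rfl fun i _ => Set.indicator_eq_indicator (h i) rfl

theorem hitCount_mono {S S' : Set Z} (h : S ⊆ S') (z : ι → Z) : hitCount S z ≤ hitCount S' z :=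
  Finset.sum_le_sum fun i _ =>
    Set.indicator_le_indicator_of_subset h (fun _ => zero_le_one) (z i)

variable [MeasurableSpace Z] {S : Set Z}

theorem measurable_hitCount (hS : MeasurableSet S) :
    Measurable fun z : ι → Z => hitCount S z :=
  Finset.measurable_sum _ fun i _ =>
    (measurable_one.indicator hS).comp (measurable_pi_apply i)

variable (P : Measure Z)

/-- The deviation `|√(n P(S)) - √(n Pₙ(S))|`, where `Pₙ` is the empirical distribution of a sample
`z` of size `n`. -/
noncomputable def sqrtDeviation (S : Set Z) (z : ι → Z) : ℝ :=
  |√(Fintype.card ι * P.real S) - √(hitCount S z)|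

theorem memLp_indicator_one [IsFiniteMeasure P] (hS : MeasurableSet S) :
    MemLp (S.indicator (1 : Z → ℝ)) 2 P :=
  memLp_indicator_const 2 hS 1 (.inr (measure_ne_top P S))

variable [IsProbabilityMeasure P]

theorem integral_hitCount (hS : MeasurableSet S) :
    ∫ z : ι → Z, hitCount S z ∂(Measure.pi fun _ => P) = Fintype.card ι * P.real S := by
  simp only [hitCount]
  rw [integral_finsetSum]
  · simp only [integral_comp_eval (μ := fun _ : ι => P) (memLp_indicator_one P hS).1,
      integral_indicator_one hS, Finset.sum_const, Finset.card_univ, nsmul_eq_mul]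
  · exact fun i _ => integrable_comp_eval ((memLp_indicator_one P hS).integrable one_le_two)

theorem variance_hitCount_le (hS : MeasurableSet S) :
    Var[fun z : ι → Z => hitCount S z; Measure.pi fun _ => P] ≤ Fintype.card ι * P.real S := by
  have variance_indicator : Var[S.indicator (1 : Z → ℝ); P] ≤ P.real S := by
    have h := variance_le_sub_mul_sub (μ := P) (a := 0) (b := 1) (X := S.indicator 1)
      (ae_of_all _ fun z => by by_cases hz : z ∈ S <;> simp [hz])
      (measurable_one.indicator hS).aemeasurable
    rw [integral_indicator_one hS] at h
    nlinarith [measureReal_nonneg (μ := P) (s := S)]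
  have sum_eq := variance_sum_pi (μ := fun _ : ι => P) (X := fun _ => S.indicator (1 : Z → ℝ))
    fun _ => memLp_indicator_one P hS
  calc Var[fun z : ι → Z => hitCount S z; Measure.pi fun _ => P]
      = ∑ _i : ι, Var[S.indicator (1 : Z → ℝ); P] := by
        rw [← sum_eq]
        congr 1
        ext z
        simp [hitCount]
    _ ≤ Fintype.card ι * P.real S := by
        rw [Finset.sum_const, Finset.card_univ, nsmul_eq_mul]
        gcongr

theorem measure_sqrt_le_abs_hitCount_sub_le (hS : MeasurableSet S) :
    Measure.pi (fun _ : ι => P) {z | √(2 * (Fintype.card ι * P.real S) + 1)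
      ≤ |hitCount S z - Fintype.card ι * P.real S|} ≤ 2⁻¹ := by
  have memLp_hitCount : MemLp (fun z : ι → Z => hitCount S z) 2 (Measure.pi fun _ => P) :=
    memLp_finsetSum _ fun i _ => (memLp_indicator_one P hS).comp_measurePreserving
      (measurePreserving_eval (fun _ : ι => P) i)
  have chebyshev := meas_ge_le_variance_div_sq memLp_hitCount
    (c := √(2 * (Fintype.card ι * P.real S) + 1)) (Real.sqrt_pos.2 (by positivity))
  rw [integral_hitCount P hS, Real.sq_sqrt (by positivity)] at chebyshev
  refine chebyshev.trans ?_
  rw [← ENNReal.ofReal_ofNat 2, ← ENNReal.ofReal_inv_of_pos two_pos]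
  refine ENNReal.ofReal_le_ofReal ?_
  rw [div_le_iff₀ (by positivity)]
  linarith [variance_hitCount_le (ι := ι) P hS]

theorem half_le_measure_sqrtDeviation_le_two (hS : MeasurableSet S) :
    2⁻¹ ≤ Measure.pi (fun _ : ι => P) {z | sqrtDeviation P S z ≤ 2} := by
  let far : Set (ι → Z) := {z | √(2 * (Fintype.card ι * P.real S) + 1)
    ≤ |hitCount S z - Fintype.card ι * P.real S|}
  have compl_subset : farᶜ ⊆ {z | sqrtDeviation P S z ≤ 2} := fun z hz => by
    have near : |hitCount S z - Fintype.card ι * P.real S|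
        < √(2 * (Fintype.card ι * P.real S) + 1) := by simpa [far] using hz
    refine abs_sqrt_sub_sqrt_le_two (by positivity) (hitCount_nonneg S z) ?_
    rw [← sq_abs]
    exact ((Real.lt_sqrt (abs_nonneg _)).1 near).le
  refine (ENNReal.add_le_add_iff_left (ENNReal.inv_ne_top.2 two_ne_zero)).1 ?_
  calc 2⁻¹ + 2⁻¹ = Measure.pi (fun _ : ι => P) Set.univ := by
        rw [ENNReal.inv_two_add_inv_two, measure_univ]
    _ ≤ Measure.pi (fun _ : ι => P) far + Measure.pi (fun _ : ι => P) farᶜ :=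
        measure_univ_le_add_compl _
    _ ≤ 2⁻¹ + Measure.pi (fun _ : ι => P) {z | sqrtDeviation P S z ≤ 2} := by
        gcongr
        exact measure_sqrt_le_abs_hitCount_sub_le P hS

end Counts

theorem measurableSet_exists_mem_lt {I W : Type*} [MeasurableSpace W] {F : Set I}
    (hF : F.Countable) {f : I → W → ℝ} (hf : ∀ S ∈ F, Measurable (f S)) (r : ℝ) :
    MeasurableSet {w | ∃ S ∈ F, r < f S w} := by
  have event_eq : {w | ∃ S ∈ F, r < f S w} = ⋃ S ∈ F, {w | r < f S w} := by ext; simp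
  rw [event_eq]
  exact MeasurableSet.biUnion hF fun S hS => measurableSet_lt measurable_const (hf S hS)

theorem measure_le_of_forall_measurePreserving {G W : Type*} [MeasurableSpace G]
    [MeasurableSpace W] {ν : Measure G} [IsProbabilityMeasure ν] {μ : Measure W}
    [IsProbabilityMeasure μ] {g : G → W → W} (hg : Measurable (Function.uncurry g))
    (hμ : ∀ σ, MeasurePreserving (g σ) μ μ) {E : Set W} (hE : MeasurableSet E) {ε : ENNReal}
    (h : ∀ w, ν {σ | g σ w ∈ E} ≤ ε) : μ E ≤ ε := by
  have measurable_hits : MeasurableSet (Function.uncurry g ⁻¹' E) := hg hE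
  calc μ E = ∫⁻ σ, μ (g σ ⁻¹' E) ∂ν := by
        simp only [(hμ _).measure_preimage hE.nullMeasurableSet, lintegral_const, measure_univ,
          mul_one]
    _ = (ν.prod μ) (Function.uncurry g ⁻¹' E) := (Measure.prod_apply measurable_hits).symm
    _ = ∫⁻ w, ν {σ | g σ w ∈ E} ∂μ := Measure.prod_apply_symm measurable_hits
    _ ≤ ∫⁻ _, ε ∂μ := lintegral_mono h
    _ = ε := by rw [lintegral_const, measure_univ, mul_one]

theorem mul_measure_le_prod_of_forall_le {W W' : Type*} [MeasurableSpace W] [MeasurableSpace W']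
    {μ : Measure W} {ν : Measure W'} [SFinite ν] {A : Set W} {E : Set (W × W')}
    (hE : MeasurableSet E) {c : ENNReal} (h : ∀ w ∈ A, c ≤ ν (Prod.mk w ⁻¹' E)) :
    c * μ A ≤ (μ.prod ν) E :=
  calc c * μ A ≤ c * μ {w | c ≤ ν (Prod.mk w ⁻¹' E)} := by gcongr; exact h
    _ ≤ ∫⁻ w, ν (Prod.mk w ⁻¹' E) ∂μ :=
        mul_meas_ge_le_lintegral (measurable_measure_prodMk_left hE) c
    _ = (μ.prod ν) E := (Measure.prod_apply hE).symm

section GhostSample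

variable {Z ι : Type*}

/-- The double sample obtained from `z` by exchanging the two members of the pairs `z i` with
`σ i = true`. -/
def swapPairs (σ : ι → Bool) (z : ι → Z × Z) : ι → Z × Z :=
  fun i => if σ i then (z i).swap else z i

theorem measurable_swapPairs [MeasurableSpace Z] :
    Measurable (Function.uncurry (swapPairs : (ι → Bool) → (ι → Z × Z) → ι → Z × Z)) := by
  refine measurable_pi_lambda _ fun i => ?_
  refine Measurable.ite (p := fun w : (ι → Bool) × (ι → Z × Z) => w.1 i = true) ?_ ?_ ?_
  · exact measurableSet_eq_fun ((measurable_pi_apply i).comp measurable_fst) measurable_const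
  · exact measurable_swap.comp ((measurable_pi_apply i).comp measurable_snd)
  · exact (measurable_pi_apply i).comp measurable_snd

variable [Fintype ι]

theorem measurePreserving_swapPairs [MeasurableSpace Z] (P : Measure Z) [SigmaFinite P]
    (σ : ι → Bool) :
    MeasurePreserving (swapPairs σ) (Measure.pi fun _ => P.prod P)
      (Measure.pi fun _ => P.prod P) := by
  refine measurePreserving_pi (f := fun i (w : Z × Z) => if σ i then w.swap else w) _ _
    fun i => ?_
  cases σ i
  · exact MeasurePreserving.id (P.prod P)
  · exact Measure.measurePreserving_swap

/-- The difference `|√(n Pₙ(S)) - √(n Pₙ'(S))|` between the empirical distributions `Pₙ` and `Pₙ'`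
of the first and of the second members of the pairs of a double sample `z` of size `n`. -/
noncomputable def ghostDeviation (S : Set Z) (z : ι → Z × Z) : ℝ :=
  |√(hitCount S fun i => (z i).1) - √(hitCount S fun i => (z i).2)|

theorem ghostDeviation_congr {S S' : Set Z} {z : ι → Z × Z}
    (h : ∀ i, ((z i).1 ∈ S ↔ (z i).1 ∈ S') ∧ ((z i).2 ∈ S ↔ (z i).2 ∈ S')) :
    ghostDeviation S z = ghostDeviation S' z := by
  rw [ghostDeviation, ghostDeviation, hitCount_congr fun i => (h i).1,
    hitCount_congr fun i => (h i).2]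

theorem ghostDeviation_swapPairs_congr {S S' : Set Z} {z : ι → Z × Z} (σ : ι → Bool)
    (h : ∀ i, ((z i).1 ∈ S ↔ (z i).1 ∈ S') ∧ ((z i).2 ∈ S ↔ (z i).2 ∈ S')) :
    ghostDeviation S (swapPairs σ z) = ghostDeviation S' (swapPairs σ z) := by
  refine ghostDeviation_congr fun i => ?_
  cases hσ : σ i
  · simpa [swapPairs, hσ] using h i
  · simpa [swapPairs, hσ] using (h i).symm

/-- The swaps only change the signs of the summands of the difference of the two counts, and keep
the sum of the counts. -/
theorem mul_sqrt_sum_sq_lt_of_lt_ghostDeviation (S : Set Z) (z : ι → Z × Z) (σ : ι → Bool) {r : ℝ}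
    (hr : 0 ≤ r) (h : r < ghostDeviation S (swapPairs σ z)) :
    r * √(∑ i, (S.indicator (1 : Z → ℝ) (z i).1 - S.indicator 1 (z i).2) ^ 2)
      < |∑ i, (S.indicator (1 : Z → ℝ) (z i).1 - S.indicator 1 (z i).2) * swapSign (σ i)| := by
  set k := hitCount S fun i => (swapPairs σ z i).1
  set k' := hitCount S fun i => (swapPairs σ z i).2
  have sub_eq : k - k'
      = ∑ i, (S.indicator (1 : Z → ℝ) (z i).1 - S.indicator 1 (z i).2) * swapSign (σ i) := by
    simp only [k, k', hitCount, ← Finset.sum_sub_distrib]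
    refine Finset.sum_congr rfl fun i _ => ?_
    cases hσ : σ i <;> simp [swapPairs, swapSign, hσ]
  have sum_sq_le : ∑ i, (S.indicator (1 : Z → ℝ) (z i).1 - S.indicator 1 (z i).2) ^ 2 ≤ k + k' := by
    simp only [k, k', hitCount, ← Finset.sum_add_distrib]
    refine Finset.sum_le_sum fun i _ => ?_
    by_cases h1 : (z i).1 ∈ S <;> by_cases h2 : (z i).2 ∈ S <;> cases hσ : σ i <;>
      simp [swapPairs, hσ, h1, h2]
  calc _ ≤ r * √(k + k') := by gcongr
    _ < |k - k'| := mul_sqrt_add_lt_abs_sub (hitCount_nonneg _ _) (hitCount_nonneg _ _) hr h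
    _ = _ := by rw [sub_eq]

theorem measure_lt_ghostDeviation_swapPairs_le (S : Set Z) (z : ι → Z × Z) {r : ℝ} (hr : 0 ≤ r) :
    (Measure.pi fun _ : ι => fairCoin) {σ | r < ghostDeviation S (swapPairs σ z)}
      ≤ ENNReal.ofReal (2 * Real.exp (-r ^ 2 / 2)) :=
  (measure_mono fun σ => mul_sqrt_sum_sq_lt_of_lt_ghostDeviation S z σ hr).trans <|
    (ENNReal.le_ofReal_iff_toReal_le (measure_ne_top _ _) (by positivity)).2 <|
      measureReal_lt_abs_sum_mul_swapSign_le _ hr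

theorem measure_exists_lt_ghostDeviation_swapPairs_le {F : Set (Set Z)} {N : ℕ} (z : ι → Z × Z)
    (hN : (Set.preimage (Sum.elim (fun i => (z i).1) fun i => (z i).2) '' F).ncard ≤ N) {r : ℝ}
    (hr : 0 ≤ r) :
    (Measure.pi fun _ : ι => fairCoin) {σ | ∃ S ∈ F, r < ghostDeviation S (swapPairs σ z)}
      ≤ N * ENNReal.ofReal (2 * Real.exp (-r ^ 2 / 2)) := by
  obtain ⟨R, hRF, hR⟩ :=
    Set.exists_subset_bijOn F (Set.preimage (Sum.elim (fun i => (z i).1) fun i => (z i).2))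
  have finite_R : R.Finite := hR.finite_iff_finite.2 (Set.toFinite _)
  have cover : {σ | ∃ S ∈ F, r < ghostDeviation S (swapPairs σ z)}
      ⊆ ⋃ S ∈ finite_R.toFinset, {σ | r < ghostDeviation S (swapPairs σ z)} := by
    rintro σ ⟨S, hS, hσ⟩
    obtain ⟨S', hS', htrace⟩ := hR.surjOn (Set.mem_image_of_mem _ hS)
    have same_trace := Set.ext_iff.1 htrace
    refine Set.mem_iUnion₂.2 ⟨S', finite_R.mem_toFinset.2 hS', ?_⟩
    rwa [Set.mem_ofPred_eq, ghostDeviation_swapPairs_congr (S := S') (S' := S) σ fun i =>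
      ⟨same_trace (.inl i), same_trace (.inr i)⟩]
  calc _ ≤ ∑ S ∈ finite_R.toFinset, (Measure.pi fun _ : ι => fairCoin)
          {σ | r < ghostDeviation S (swapPairs σ z)} :=
        (measure_mono cover).trans (measure_biUnion_finset_le _ _)
    _ ≤ finite_R.toFinset.card • ENNReal.ofReal (2 * Real.exp (-r ^ 2 / 2)) :=
        Finset.sum_le_card_nsmul _ _ _ fun S _ => measure_lt_ghostDeviation_swapPairs_le S z hr
    _ ≤ N * ENNReal.ofReal (2 * Real.exp (-r ^ 2 / 2)) := by
        rw [nsmul_eq_mul, ← Set.ncard_eq_toFinset_card R finite_R]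
        gcongr
        rwa [← hR.image_eq, hR.injOn.ncard_image] at hN

variable [MeasurableSpace Z]

theorem measurable_ghostDeviation {S : Set Z} (hS : MeasurableSet S) :
    Measurable fun z : ι → Z × Z => ghostDeviation S z := by
  have := measurable_hitCount (ι := ι) hS
  unfold ghostDeviation
  fun_prop

theorem measurableSet_exists_lt_ghostDeviation {F : Set (Set Z)} (hF : F.Countable)
    (hFm : ∀ S ∈ F, MeasurableSet S) (r : ℝ) :
    MeasurableSet {z : ι → Z × Z | ∃ S ∈ F, r < ghostDeviation S z} :=
  measurableSet_exists_mem_lt hF (fun S hS => measurable_ghostDeviation (hFm S hS)) r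

variable (P : Measure Z) [IsProbabilityMeasure P]

theorem measure_exists_lt_ghostDeviation_le {F : Set (Set Z)} (hF : F.Countable)
    (hFm : ∀ S ∈ F, MeasurableSet S) {N : ℕ}
    (hN : ∀ y : ι ⊕ ι → Z, (Set.preimage y '' F).ncard ≤ N) {r : ℝ} (hr : 0 ≤ r) :
    (Measure.pi fun _ : ι => P.prod P) {z | ∃ S ∈ F, r < ghostDeviation S z}
      ≤ N * ENNReal.ofReal (2 * Real.exp (-r ^ 2 / 2)) :=
  measure_le_of_forall_measurePreserving measurable_swapPairs (measurePreserving_swapPairs P)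
    (measurableSet_exists_lt_ghostDeviation hF hFm r) fun z =>
      measure_exists_lt_ghostDeviation_swapPairs_le z (hN _) hr

/-- Symmetrisation: if a set deviates from `P` on the first sample, then it deviates from the second
sample, on which its deviation from `P` is small with probability at least `1 / 2`. -/
theorem measure_exists_lt_sqrtDeviation_le_two_mul {F : Set (Set Z)} (hF : F.Countable)
    (hFm : ∀ S ∈ F, MeasurableSet S) (r : ℝ) :
    (Measure.pi fun _ : ι => P) {z | ∃ S ∈ F, r + 2 < sqrtDeviation P S z}
      ≤ 2 * (Measure.pi fun _ : ι => P.prod P) {z | ∃ S ∈ F, r < ghostDeviation S z} := by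
  let pairUp : (ι → Z) × (ι → Z) ≃ᵐ (ι → Z × Z) :=
    (MeasurableEquiv.arrowProdEquivProdArrow Z Z ι).symm
  have pairUp_preserving : MeasurePreserving pairUp
      ((Measure.pi fun _ => P).prod (Measure.pi fun _ => P)) (Measure.pi fun _ => P.prod P) :=
    (measurePreserving_arrowProdEquivProdArrow Z Z ι (fun _ => P) fun _ => P).symm
  let E : Set (ι → Z × Z) := {z | ∃ S ∈ F, r < ghostDeviation S z}
  have measurable_E : MeasurableSet E := measurableSet_exists_lt_ghostDeviation hF hFm r
  have ghost_prob : ∀ z ∈ {z : ι → Z | ∃ S ∈ F, r + 2 < sqrtDeviation P S z},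
      2⁻¹ ≤ Measure.pi (fun _ : ι => P) (Prod.mk z ⁻¹' (pairUp ⁻¹' E)) := by
    rintro z ⟨S, hS, hz⟩
    refine (half_le_measure_sqrtDeviation_le_two P (hFm S hS)).trans (measure_mono fun z' hz' => ?_)
    have triangle := abs_sub_le √(Fintype.card ι * P.real S) √(hitCount S z') √(hitCount S z)
    rw [abs_sub_comm √(hitCount S z')] at triangle
    refine ⟨S, hS, lt_of_add_lt_add_right (a := 2) (hz.trans_le (triangle.trans ?_))⟩
    exact (add_comm _ _).trans_le (add_le_add_right hz' _)
  calc _ = 2 * (2⁻¹ * Measure.pi (fun _ => P) {z | ∃ S ∈ F, r + 2 < sqrtDeviation P S z}) := by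
        rw [← mul_assoc, ENNReal.mul_inv_cancel two_ne_zero ENNReal.ofNat_ne_top, one_mul]
    _ ≤ 2 * ((Measure.pi fun _ : ι => P).prod (Measure.pi fun _ => P)) (pairUp ⁻¹' E) := by
        gcongr
        exact mul_measure_le_prod_of_forall_le (pairUp.measurable measurable_E) ghost_prob
    _ = 2 * (Measure.pi fun _ : ι => P.prod P) E := by
        rw [pairUp_preserving.measure_preimage_equiv]

theorem measure_exists_lt_sqrtDeviation_le {F : Set (Set Z)} (hF : F.Countable)
    (hFm : ∀ S ∈ F, MeasurableSet S) {N : ℕ}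
    (hN : ∀ y : ι ⊕ ι → Z, (Set.preimage y '' F).ncard ≤ N) {r : ℝ} (hr : 0 ≤ r) :
    (Measure.pi fun _ : ι => P) {z | ∃ S ∈ F, r + 2 < sqrtDeviation P S z}
      ≤ N * ENNReal.ofReal (4 * Real.exp (-r ^ 2 / 2)) :=
  calc (Measure.pi fun _ : ι => P) {z | ∃ S ∈ F, r + 2 < sqrtDeviation P S z}
      ≤ 2 * (N * ENNReal.ofReal (2 * Real.exp (-r ^ 2 / 2))) := by
        refine (measure_exists_lt_sqrtDeviation_le_two_mul P hF hFm r).trans ?_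
        gcongr
        exact measure_exists_lt_ghostDeviation_le P hF hFm hN hr
    _ = N * ENNReal.ofReal (4 * Real.exp (-r ^ 2 / 2)) := by
        rw [mul_left_comm, ← ENNReal.ofReal_ofNat 2, ← ENNReal.ofReal_mul two_pos.le, ← mul_assoc]
        norm_num

end GhostSample

section RandomClass

variable {Θ Z ι : Type*} [MeasurableSpace Θ] [MeasurableSpace Z] [Fintype ι]

theorem map_prodMk_eq_prod_pi {Ω : Type*} [MeasurableSpace Ω] {μ : Measure Ω}
    [IsProbabilityMeasure μ] {P : Measure Z} {W : ι → Ω → Z} (hW : ∀ i, Measurable (W i))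
    (hlaw : ∀ i, μ.map (W i) = P) (hindep : iIndepFun W μ) {T : Ω → Θ} (hT : Measurable T)
    (hTW : IndepFun T (fun ω i => W i ω) μ) :
    μ.map (fun ω => (T ω, fun i => W i ω)) = (μ.map T).prod (Measure.pi fun _ => P) := by
  rw [(indepFun_iff_map_prod_eq_prod_map_map hT.aemeasurable
    (measurable_pi_lambda _ hW).aemeasurable).1 hTW]
  simp_rw [(iIndepFun_iff_map_fun_eq_pi_map fun i => (hW i).aemeasurable).1 hindep, hlaw]

theorem measure_prod_le_of_forall_le {Ξ : Type*} [MeasurableSpace Ξ] {ν : Measure Θ}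
    [IsProbabilityMeasure ν] {π : Measure Ξ} [SFinite π] {D : Set (Θ × Ξ)} (hD : MeasurableSet D)
    {ε : ENNReal} (h : ∀ θ, π (Prod.mk θ ⁻¹' D) ≤ ε) : (ν.prod π) D ≤ ε :=
  calc (ν.prod π) D = ∫⁻ θ, π (Prod.mk θ ⁻¹' D) ∂ν := Measure.prod_apply hD
    _ ≤ ∫⁻ _, ε ∂ν := lintegral_mono h
    _ = ε := by rw [lintegral_const, measure_univ, mul_one]

theorem measurable_sqrtDeviation_prodMk_preimage (P : Measure Z) [SFinite P]
    {G : Set (Θ × Z)} (hG : MeasurableSet G) :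
    Measurable fun w : Θ × (ι → Z) => sqrtDeviation P (Prod.mk w.1 ⁻¹' G) w.2 := by
  have mass : Measurable fun w : Θ × (ι → Z) => P.real (Prod.mk w.1 ⁻¹' G) :=
    (measurable_measure_prodMk_left hG).ennreal_toReal.comp measurable_fst
  have count : Measurable fun w : Θ × (ι → Z) => hitCount (Prod.mk w.1 ⁻¹' G) w.2 := by
    refine Finset.measurable_sum _ fun i _ => ?_
    change Measurable fun w : Θ × (ι → Z) => G.indicator (1 : Θ × Z → ℝ) (w.1, w.2 i)
    exact (measurable_one.indicator hG).comp (by fun_prop)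
  unfold sqrtDeviation
  fun_prop

variable {X : Type*} [MeasurableSpace X] (ν : Measure Θ) [IsProbabilityMeasure ν] (P : Measure Z)
  [IsProbabilityMeasure P] {f : Z → X} {F : Set (Set X)} {A : Set (Θ × Z)} {N : ℕ} {r : ℝ}

theorem measure_prod_exists_lt_sqrtDeviation_inter_le (hf : Measurable f) (hF : F.Countable)
    (hFm : ∀ S ∈ F, MeasurableSet S) (hN : ∀ y : ι ⊕ ι → X, (Set.preimage y '' F).ncard ≤ N)
    (hA : MeasurableSet A) (hr : 0 ≤ r) :
    (ν.prod (Measure.pi fun _ : ι => P))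
        {w | ∃ S ∈ F, r + 2 < sqrtDeviation P (f ⁻¹' S ∩ Prod.mk w.1 ⁻¹' A) w.2}
      ≤ N * ENNReal.ofReal (4 * Real.exp (-r ^ 2 / 2)) := by
  refine measure_prod_le_of_forall_le (measurableSet_exists_mem_lt hF (fun S hS => ?_) _)
    fun θ => ?_
  · exact measurable_sqrtDeviation_prodMk_preimage P
      (G := (f ∘ Prod.snd) ⁻¹' S ∩ A) ((hf.comp measurable_snd (hFm S hS)).inter hA)
  · have uniform := measure_exists_lt_sqrtDeviation_le P (ι := ι) (N := N) (r := r)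
      (hF.image fun S => f ⁻¹' S ∩ Prod.mk θ ⁻¹' A)
      (Set.forall_mem_image.2 fun S hS => (hf (hFm S hS)).inter (measurable_prodMk_left hA))
      (fun y => (ncard_preimage_image_le_ncard_preimage_comp F f _ y).trans (hN _)) hr
    simp only [Set.exists_mem_image] at uniform
    exact uniform

end RandomClass

section PointwiseSeparable

/-- A class of sets is pointwise separable (a *pointwise measurable class* in empirical process
theory) if each of its members is the pointwise limit of a sequence of members of a fixed countable
subclass. Suprema over the class of functionals that are continuous along such sequences, like the
deviation of an empirical distribution, reduce to the countable subclass. -/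
def IsPointwiseSeparable {X : Type*} (F : Set (Set X)) : Prop :=
  ∃ F₀ ⊆ F, F₀.Countable ∧
    ∀ S ∈ F, ∃ s : ℕ → Set X, (∀ k, s k ∈ F₀) ∧ ∀ x, ∀ᶠ k in atTop, (x ∈ s k ↔ x ∈ S)

theorem tendsto_sqrtDeviation {Z ι : Type*} [MeasurableSpace Z] [Fintype ι] (P : Measure Z)
    [IsFiniteMeasure P] {s : ℕ → Set Z} {S : Set Z} (hs : ∀ k, MeasurableSet (s k))
    (hlim : ∀ x, ∀ᶠ k in atTop, (x ∈ s k ↔ x ∈ S)) (z : ι → Z) :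
    Tendsto (fun k => sqrtDeviation P (s k) z) atTop (𝓝 (sqrtDeviation P S z)) := by
  have mass : Tendsto (fun k => P.real (s k)) atTop (𝓝 (P.real S)) :=
    (ENNReal.tendsto_toReal (measure_ne_top P S)).comp
      (tendsto_measure_of_tendsto_indicator_of_isFiniteMeasure atTop P hs hlim)
  have count : (fun _ => hitCount S z) =ᶠ[atTop] fun k => hitCount (s k) z := by
    filter_upwards [eventually_all.2 fun i => hlim (z i)] with k hk
    exact hitCount_congr fun i => (hk i).symm
  exact ((mass.const_mul _).sqrt.sub (tendsto_const_nhds.congr' count).sqrt).abs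

theorem IsPointwiseSeparable.measure_prod_exists_lt_sqrtDeviation_inter_le {Θ Z X ι : Type*}
    [MeasurableSpace Θ] [MeasurableSpace Z] [MeasurableSpace X] [Fintype ι] (ν : Measure Θ)
    [IsProbabilityMeasure ν] (P : Measure Z) [IsProbabilityMeasure P] {f : Z → X}
    (hf : Measurable f) {F : Set (Set X)} (hF : IsPointwiseSeparable F)
    (hFm : ∀ S ∈ F, MeasurableSet S) {N : ℕ}
    (hN : ∀ y : ι ⊕ ι → X, (Set.preimage y '' F).ncard ≤ N) {A : Set (Θ × Z)}
    (hA : MeasurableSet A) {r : ℝ} (hr : 0 ≤ r) :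
    (ν.prod (Measure.pi fun _ : ι => P))
        {w | ∃ S ∈ F, r + 2 < sqrtDeviation P (f ⁻¹' S ∩ Prod.mk w.1 ⁻¹' A) w.2}
      ≤ N * ENNReal.ofReal (4 * Real.exp (-r ^ 2 / 2)) := by
  obtain ⟨F₀, hF₀F, hF₀, happrox⟩ := hF
  have ncard_F₀ (y : ι ⊕ ι → X) : (Set.preimage y '' F₀).ncard ≤ N :=
    (Set.ncard_le_ncard (Set.image_mono hF₀F) (Set.toFinite _)).trans (hN y)
  refine (measure_mono ?_).trans (_root_.measure_prod_exists_lt_sqrtDeviation_inter_le ν P hf hF₀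
    (fun S hS => hFm S (hF₀F hS)) ncard_F₀ hA hr)
  rintro ⟨θ, z⟩ ⟨S, hS, hlt⟩
  obtain ⟨s, hsF₀, hlim⟩ := happrox S hS
  have tendsto := tendsto_sqrtDeviation P
    (s := fun k => f ⁻¹' s k ∩ Prod.mk θ ⁻¹' A) (S := f ⁻¹' S ∩ Prod.mk θ ⁻¹' A)
    (fun k => (hf (hFm _ (hF₀F (hsF₀ k)))).inter (measurable_prodMk_left hA))
    (fun x => (hlim (f x)).mono fun k hk => and_congr_left fun _ => hk) z
  obtain ⟨k, hk⟩ := (tendsto.eventually_const_lt hlt).exists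
  exact ⟨s k, hsF₀ k, hk⟩

end PointwiseSeparable

theorem abs_inner_sub_inner_le_of_dist_le_sq {E : Type*} [SeminormedAddCommGroup E]
    [InnerProductSpace ℝ E] {v w x : E} {ε : ℝ} (hε : 0 ≤ ε) (hw : dist w v ≤ ε ^ 2)
    (hx : ε * ‖x‖ ≤ 1) :
    |(inner ℝ w x : ℝ) - inner ℝ v x| ≤ ε :=
  calc |(inner ℝ w x : ℝ) - inner ℝ v x| ≤ ‖w - v‖ * ‖x‖ := by
        rw [← inner_sub_left]
        exact abs_real_inner_le_norm _ _
    _ ≤ ε ^ 2 * ‖x‖ := by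
        rw [← dist_eq_norm]
        gcongr
    _ = ε * (ε * ‖x‖) := by ring
    _ ≤ ε := mul_le_of_le_one_right hε hx

section Slabs

variable {d : ℕ} {v : EuclideanSpace ℝ (Fin d)} {a b : ℝ}

theorem measurableSet_slab : MeasurableSet (slab v a b) := by
  have measurable_inner : Measurable fun x : EuclideanSpace ℝ (Fin d) => inner ℝ v x := by fun_prop
  exact measurable_inner measurableSet_Icc

/-- The approximating slabs are wider than `slab v a b` by more than the error in the direction, so
that they keep its boundary points. -/
theorem eventually_mem_slab_iff {w : ℕ → EuclideanSpace ℝ (Fin d)} {α β ε : ℕ → ℝ}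
    (hε : Tendsto ε atTop (𝓝 0)) (hε0 : ∀ k, 0 ≤ ε k) (hw : ∀ k, dist (w k) v ≤ ε k ^ 2)
    (hα : ∀ k, α k ∈ Set.Icc (a - 2 * ε k) (a - ε k))
    (hβ : ∀ k, β k ∈ Set.Icc (b + ε k) (b + 2 * ε k)) (x : EuclideanSpace ℝ (Fin d)) :
    ∀ᶠ k in atTop, (x ∈ slab (w k) (α k) (β k) ↔ x ∈ slab v a b) := by
  have inner_close : ∀ᶠ k in atTop, |(inner ℝ (w k) x : ℝ) - inner ℝ v x| ≤ ε k := by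
    have mul_norm_small : ∀ᶠ k in atTop, ε k * ‖x‖ < 1 :=
      (hε.mul_const ‖x‖).eventually_lt_const (by simp)
    filter_upwards [mul_norm_small] with k hk
    exact abs_inner_sub_inner_le_of_dist_le_sq (hε0 k) (hw k) hk.le
  have eventually_small {c : ℝ} (hc : 0 < c) : ∀ᶠ k in atTop, 3 * ε k < c :=
    (hε.const_mul 3).eventually_lt_const (by simpa using hc)
  by_cases hx : x ∈ slab v a b
  · filter_upwards [inner_close] with k hk
    obtain ⟨lower, upper⟩ := abs_le.1 hk
    exact iff_of_true ⟨by linarith [(hα k).2, hx.1], by linarith [(hβ k).1, hx.2]⟩ hx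
  · rcases not_and_or.1 hx with below | above
    · filter_upwards [inner_close, eventually_small (sub_pos.2 (not_le.1 below))] with k hk small
      refine iff_of_false (fun hmem => ?_) hx
      linarith [hmem.1, (hα k).1, (abs_le.1 hk).2]
    · filter_upwards [inner_close, eventually_small (sub_pos.2 (not_le.1 above))] with k hk small
      refine iff_of_false (fun hmem => ?_) hx
      linarith [hmem.2, (hβ k).2, (abs_le.1 hk).1]

theorem isPointwiseSeparable_slabs (V : Set (EuclideanSpace ℝ (Fin d))) :
    IsPointwiseSeparable (slabs V) := by
  obtain ⟨V₀, hV₀V, hV₀, hdense⟩ :=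
    (TopologicalSpace.IsSeparable.of_separableSpace V).exists_countable_dense_subset
  refine ⟨(fun p : EuclideanSpace ℝ (Fin d) × ℚ × ℚ => slab p.1 p.2.1 p.2.2) '' (V₀ ×ˢ Set.univ),
    ?_, (hV₀.prod Set.countable_univ).image _, ?_⟩
  · rintro _ ⟨⟨w, α, β⟩, ⟨hw, -⟩, rfl⟩
    exact ⟨w, hV₀V hw, α, β, rfl⟩
  · rintro _ ⟨v, hv, a, b, rfl⟩
    let ε : ℕ → ℝ := fun k => 1 / (k + 1)
    have ε_pos (k : ℕ) : 0 < ε k := Nat.one_div_pos_of_nat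
    choose w hwV₀ hw using fun k =>
      Metric.mem_closure_iff.1 (hdense hv) (ε k ^ 2) (pow_pos (ε_pos k) 2)
    choose α hα using fun k =>
      exists_rat_btwn (show a - 2 * ε k < a - ε k by linarith [ε_pos k])
    choose β hβ using fun k =>
      exists_rat_btwn (show b + ε k < b + 2 * ε k by linarith [ε_pos k])
    refine ⟨fun k => slab (w k) (α k) (β k), fun k => ⟨(w k, α k, β k), ⟨hwV₀ k, trivial⟩, rfl⟩, ?_⟩
    exact eventually_mem_slab_iff tendsto_one_div_add_atTop_nhds_zero_nat (fun k => (ε_pos k).le)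
      (fun k => (dist_comm _ _).trans_le (hw k).le) (fun k => ⟨(hα k).1.le, (hα k).2.le⟩)
      (fun k => ⟨(hβ k).1.le, (hβ k).2.le⟩)

end Slabs

section ConditionalCoverage

theorem empiricalDist_real {Z : Type*} [MeasurableSpace Z] {n : ℕ} (z : Fin n → Z) {S : Set Z}
    (hS : MeasurableSet S) : (empiricalDist z).real S = hitCount S z / n := by
  have dirac_real (i : Fin n) : (Measure.dirac (z i)).real S = S.indicator 1 (z i) := by
    by_cases hi : z i ∈ S <;> simp [measureReal_def, Measure.dirac_apply' _ hS, hi]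
  rw [empiricalDist, measureReal_ennreal_smul_apply, measureReal_def, Measure.finsetSum_apply,
    ENNReal.toReal_sum fun i _ => measure_ne_top _ _]
  simp only [← measureReal_def, dirac_real, hitCount]
  rw [ENNReal.toReal_inv, ENNReal.toReal_natCast, inv_mul_eq_div]

variable {X Y : Type*} [MeasurableSpace X] [MeasurableSpace Y]

theorem condCoverage_eq_div (Q : Measure (X × Y)) (C : X → Set Y) {S : Set X}
    (hS : MeasurableSet S) :
    condCoverage Q C S
      = Q.real (Prod.fst ⁻¹' S ∩ {z | z.2 ∈ C z.1}) / Q.real (Prod.fst ⁻¹' S) := by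
  change (Q[{z | z.2 ∈ C z.1} | Prod.fst ⁻¹' S]).toReal = _
  rw [cond_apply (measurable_fst hS), ENNReal.toReal_mul, ENNReal.toReal_inv, inv_mul_eq_div]
  rfl

/-- In terms of square roots `a`, `b`, `A`, `B` of counts, the difference of the ratios factors as
`(b / a - B / A) * (b / a + B / A)`, where the second factor is at most `2`. -/
theorem abs_sq_div_sq_sub_le {a b A B ρ : ℝ} (ha : 0 < a) (hb : 0 ≤ b) (hB : 0 ≤ B) (hba : b ≤ a)
    (hBA : B ≤ A) (hA : |A - a| ≤ ρ) (hBb : |B - b| ≤ ρ) :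
    |b ^ 2 / a ^ 2 - B ^ 2 / A ^ 2| ≤ 4 * ρ / a := by
  have hx : b / a ≤ 1 := div_le_one_of_le₀ hba ha.le
  have hy : B / A ≤ 1 := div_le_one_of_le₀ hBA (hB.trans hBA)
  have hx0 : 0 ≤ b / a := by positivity
  have hy0 : 0 ≤ B / A := div_nonneg hB (hB.trans hBA)
  have diff_eq : b / a - B / A = (B / A * (A - a) - (B - b)) / a := by
    rcases (hB.trans hBA).eq_or_lt with hA0 | hApos
    · obtain rfl : B = 0 := le_antisymm (hA0 ▸ hBA) hB
      simp
    · field_simp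
      ring
  have diff_le : |b / a - B / A| ≤ 2 * ρ / a := by
    rw [diff_eq, abs_div, abs_of_pos ha]
    gcongr
    calc |B / A * (A - a) - (B - b)| ≤ |B / A| * |A - a| + |B - b| := by
          rw [← abs_mul]
          exact abs_sub _ _
      _ ≤ 1 * ρ + ρ := by
          rw [abs_of_nonneg hy0]
          gcongr
      _ = 2 * ρ := by ring
  calc |b ^ 2 / a ^ 2 - B ^ 2 / A ^ 2| = |b / a - B / A| * (b / a + B / A) := by
        rw [← div_pow, ← div_pow, sq_sub_sq, abs_mul, abs_of_nonneg (add_nonneg hx0 hy0), mul_comm]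
    _ ≤ 2 * ρ / a * 2 := by
        have hρ : 0 ≤ ρ := (abs_nonneg _).trans hA
        gcongr
        linarith
    _ = 4 * ρ / a := by ring

theorem abs_condCoverage_sub_le (P : Measure (X × Y)) [IsFiniteMeasure P] {n : ℕ}
    (z : Fin n → X × Y) {C : X → Set Y} (hC : MeasurableSet {z : X × Y | z.2 ∈ C z.1}) {S : Set X}
    (hS : MeasurableSet S) {δ ρ : ℝ} (hδn : 0 < δ * n) (hmass : δ ≤ slabMass (empiricalDist z) S)
    (hdev : sqrtDeviation P (Prod.fst ⁻¹' S) z ≤ ρ)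
    (hdevC : sqrtDeviation P (Prod.fst ⁻¹' S ∩ {z | z.2 ∈ C z.1}) z ≤ ρ) :
    |condCoverage (empiricalDist z) C S - condCoverage P C S| ≤ 4 * ρ / √(δ * n) := by
  have hS' : MeasurableSet (Prod.fst ⁻¹' S : Set (X × Y)) := measurable_fst hS
  set covered : Set (X × Y) := Prod.fst ⁻¹' S ∩ {z | z.2 ∈ C z.1}
  have hn : (0 : ℝ) < n := (Nat.cast_nonneg n).lt_of_ne' fun h => by simp [h] at hδn
  have count_ge : δ * n ≤ hitCount (Prod.fst ⁻¹' S) z := by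
    rw [← le_div_iff₀ hn, ← empiricalDist_real z hS']
    exact hmass
  have empirical : condCoverage (empiricalDist z) C S
      = √(hitCount covered z) ^ 2 / √(hitCount (Prod.fst ⁻¹' S) z) ^ 2 := by
    rw [condCoverage_eq_div _ C hS, empiricalDist_real z hS', empiricalDist_real z (hS'.inter hC),
      div_div_div_cancel_right₀ hn.ne', Real.sq_sqrt (hitCount_nonneg _ z),
      Real.sq_sqrt (hitCount_nonneg _ z)]
  have population : condCoverage P C S
      = √(n * P.real covered) ^ 2 / √(n * P.real (Prod.fst ⁻¹' S)) ^ 2 := by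
    rw [condCoverage_eq_div _ C hS, Real.sq_sqrt (by positivity), Real.sq_sqrt (by positivity),
      mul_div_mul_left _ _ hn.ne']
  rw [sqrtDeviation, Fintype.card_fin] at hdev hdevC
  calc |condCoverage (empiricalDist z) C S - condCoverage P C S|
      ≤ 4 * ρ / √(hitCount (Prod.fst ⁻¹' S) z) := by
        rw [empirical, population]
        refine abs_sq_div_sq_sub_le (Real.sqrt_pos.2 (hδn.trans_le count_ge)) (Real.sqrt_nonneg _)
          (Real.sqrt_nonneg _) (Real.sqrt_le_sqrt (hitCount_mono Set.inter_subset_left z))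
          (Real.sqrt_le_sqrt ?_) hdev hdevC
        exact mul_le_mul_of_nonneg_left (measureReal_mono Set.inter_subset_left) hn.le
    _ ≤ 4 * ρ / √(δ * n) := by
        have hρ : 0 ≤ ρ := (abs_nonneg _).trans hdev
        gcongr

end ConditionalCoverage

theorem measure_prod_condCoverage_deviation_le {X Y Θ : Type*} [MeasurableSpace X]
    [MeasurableSpace Y] [MeasurableSpace Θ] (ν : Measure Θ) [IsProbabilityMeasure ν]
    (P : Measure (X × Y)) [IsProbabilityMeasure P] {F : Set (Set X)} (hF : IsPointwiseSeparable F)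
    (hFm : ∀ S ∈ F, MeasurableSet S) {n N : ℕ}
    (hN : ∀ y : Fin n ⊕ Fin n → X, (Set.preimage y '' F).ncard ≤ N) {C : Θ → X → Set Y}
    (hC : MeasurableSet {w : Θ × (X × Y) | w.2.2 ∈ C w.1 w.2.1}) {δ : ℝ} (hδn : 0 < δ * n) {r : ℝ}
    (hr : 0 ≤ r) :
    (ν.prod (Measure.pi fun _ : Fin n => P)) {w | ¬ ∀ S ∈ F, δ ≤ slabMass (empiricalDist w.2) S →
        |condCoverage (empiricalDist w.2) (C w.1) S - condCoverage P (C w.1) S|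
          ≤ 4 * (r + 2) / √(δ * n)}
      ≤ N * ENNReal.ofReal (8 * Real.exp (-r ^ 2 / 2)) := by
  let deviates (A : Set (Θ × (X × Y))) : Set (Θ × (Fin n → X × Y)) :=
    {w | ∃ S ∈ F, r + 2 < sqrtDeviation P (Prod.fst ⁻¹' S ∩ Prod.mk w.1 ⁻¹' A) w.2}
  have deviates_le {A : Set (Θ × (X × Y))} (hA : MeasurableSet A) :
      (ν.prod (Measure.pi fun _ => P)) (deviates A)
        ≤ N * ENNReal.ofReal (4 * Real.exp (-r ^ 2 / 2)) :=
    hF.measure_prod_exists_lt_sqrtDeviation_inter_le ν P measurable_fst hFm hN hA hr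
  let graph : Set (Θ × (X × Y)) := {w | w.2.2 ∈ C w.1 w.2.1}
  have measurable_covered (θ : Θ) : MeasurableSet {z : X × Y | z.2 ∈ C θ z.1} :=
    measurable_prodMk_left hC
  calc _ ≤ (ν.prod (Measure.pi fun _ => P)) (deviates Set.univ ∪ deviates graph) := by
        refine measure_mono fun w hw => ?_
        by_contra hgood
        obtain ⟨mass_good, covered_good⟩ := not_or.1 hgood
        refine hw fun S hS hmass => abs_condCoverage_sub_le P _ (measurable_covered w.1)
          (hFm S hS) hδn hmass (not_lt.1 fun hlt => mass_good ⟨S, hS, ?_⟩)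
          (not_lt.1 fun hlt => covered_good ⟨S, hS, hlt⟩)
        rwa [Set.preimage_univ, Set.inter_univ]
    _ ≤ N * ENNReal.ofReal (4 * Real.exp (-r ^ 2 / 2))
          + N * ENNReal.ofReal (4 * Real.exp (-r ^ 2 / 2)) :=
        (measure_union_le _ _).trans (add_le_add (deviates_le MeasurableSet.univ) (deviates_le hC))
    _ = N * ENNReal.ofReal (8 * Real.exp (-r ^ 2 / 2)) := by
        rw [← mul_add, ← ENNReal.ofReal_add (by positivity) (by positivity)]
        ring_nf

section Constants

variable {n v : ℕ} {t : ℝ}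

theorem half_le_max_one_mul_log_add (hn : 2 ≤ n) (ht : 0 ≤ t) :
    1 / 2 ≤ max 1 (v : ℝ) * Real.log n + t := by
  have log_two_le : Real.log 2 ≤ Real.log n := Real.log_le_log two_pos (by exact_mod_cast hn)
  have log_le : Real.log n ≤ max 1 (v : ℝ) * Real.log n :=
    le_mul_of_one_le_left (Real.log_natCast_nonneg n) (le_max_left _ _)
  linarith [Real.log_two_gt_d9]

theorem pow_succ_mul_exp_le {r : ℝ} (hn : 2 ≤ n) (ht : 0 ≤ t)
    (hr : r ^ 2 = 36 * (max 1 (v : ℝ) * Real.log n + t)) :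
    (((n + n) ^ 2 + 1) ^ (v + 1) : ℝ) * (8 * Real.exp (-r ^ 2 / 2)) ≤ Real.exp (-t) := by
  have hn' : (2 : ℝ) ≤ n := by exact_mod_cast hn
  have eight_le : (8 : ℝ) ≤ n ^ 3 := by
    calc (8 : ℝ) = 2 ^ 3 := by norm_num
      _ ≤ n ^ 3 := by gcongr
  have base_le : ((n + n) ^ 2 + 1 : ℝ) ≤ n ^ 5 := by
    calc ((n + n) ^ 2 + 1 : ℝ) ≤ 8 * n ^ 2 := by nlinarith
      _ ≤ n ^ 3 * n ^ 2 := by gcongr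
      _ = n ^ 5 := by ring
  have exponent_le : Real.log n * (5 * (v + 1) + 3 : ℕ) ≤ 18 * (max 1 (v : ℝ) * Real.log n) := by
    have : ((5 * (v + 1) + 3 : ℕ) : ℝ) ≤ 18 * max 1 (v : ℝ) := by
      push_cast
      linarith [le_max_left 1 (v : ℝ), le_max_right 1 (v : ℝ)]
    nlinarith [Real.log_natCast_nonneg n]
  calc (((n + n) ^ 2 + 1) ^ (v + 1) : ℝ) * (8 * Real.exp (-r ^ 2 / 2))
      ≤ ((n : ℝ) ^ 5) ^ (v + 1) * (n ^ 3 * Real.exp (-r ^ 2 / 2)) := by gcongr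
    _ = Real.exp (Real.log n * (5 * (v + 1) + 3 : ℕ) + -r ^ 2 / 2) := by
        rw [← mul_assoc, ← pow_mul, ← pow_add, ← Real.rpow_natCast,
          Real.rpow_def_of_pos (by linarith), ← Real.exp_add]
    _ ≤ Real.exp (-t) := Real.exp_le_exp.2 (by linarith)

theorem four_mul_add_two_div_sqrt_le {L D : ℝ} (hL : 1 / 2 ≤ L) :
    4 * (6 * √L + 2) / √D ≤ 36 * √(L / D) := by
  have two_le : 2 ≤ 3 * √L := by
    have : 2 / 3 ≤ √L := Real.le_sqrt_of_sq_le (by linarith)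
    linarith
  rw [Real.sqrt_div (by linarith), ← mul_div_assoc]
  exact div_le_div_of_nonneg_right (by linarith) (Real.sqrt_nonneg D)

end Constants

theorem measure_prod_slabs_condCoverage_deviation_le {d : ℕ} (V : Set (EuclideanSpace ℝ (Fin d)))
    {Y Θ : Type*} [MeasurableSpace Y] [MeasurableSpace Θ] (ν : Measure Θ) [IsProbabilityMeasure ν]
    (P : Measure (EuclideanSpace ℝ (Fin d) × Y)) [IsProbabilityMeasure P] {n : ℕ} (hn : 2 ≤ n)
    {C : Θ → EuclideanSpace ℝ (Fin d) → Set Y}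
    (hC : MeasurableSet {w : Θ × (EuclideanSpace ℝ (Fin d) × Y) | w.2.2 ∈ C w.1 w.2.1}) {δ : ℝ}
    (hδ : 0 < δ) {t : ℝ} (ht : 0 ≤ t) :
    (ν.prod (Measure.pi fun _ : Fin n => P))
        {w | ¬ ∀ S ∈ slabs V, δ ≤ slabMass (empiricalDist w.2) S →
          |condCoverage (empiricalDist w.2) (C w.1) S - condCoverage P (C w.1) S|
            ≤ 36 * √((max 1 ((VC V).toNat : ℝ) * Real.log n + t) / (δ * n))}
      ≤ ENNReal.ofReal (Real.exp (-t)) := by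
  set L : ℝ := max 1 ((VC V).toNat : ℝ) * Real.log n + t
  have half_le_L : 1 / 2 ≤ L := half_le_max_one_mul_log_add hn ht
  have traces (y : Fin n ⊕ Fin n → EuclideanSpace ℝ (Fin d)) :
      (Set.preimage y '' slabs V).ncard ≤ ((n + n) ^ 2 + 1) ^ ((VC V).toNat + 1) := by
    simpa only [Fintype.card_sum, Fintype.card_fin] using ncard_preimage_slabs_le V y
  have measurable_slabs : ∀ S ∈ slabs V, MeasurableSet S := by
    rintro _ ⟨v, -, a, b, rfl⟩
    exact measurableSet_slab
  have deviation_le := measure_prod_condCoverage_deviation_le ν P (isPointwiseSeparable_slabs V)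
    measurable_slabs traces hC (mul_pos hδ (by positivity)) (r := 6 * √L) (by positivity)
  refine (measure_mono ?_).trans (deviation_le.trans ?_)
  · exact fun w hw hdev => hw fun S hS hmass =>
      (hdev S hS hmass).trans (four_mul_add_two_div_sqrt_le half_le_L)
  · rw [← ENNReal.ofReal_natCast, ← ENNReal.ofReal_mul (by positivity)]
    refine ENNReal.ofReal_le_ofReal ?_
    push_cast
    refine pow_succ_mul_exp_le hn ht ?_
    rw [mul_pow, Real.sq_sqrt (by linarith)]
    norm_num [L]

/-- `T` is the information from which the confidence set is built (its score `s (T ω)` and threshold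
`q (T ω)`), independent of the sample `Z`. "With probability at least `1 - exp (-t)`" is stated as
the bound `exp (-t)` on the (outer) measure of the complementary event, which needs no measurability
of the supremum over slabs. -/
theorem mainTheorem8 :
    ∃ K : ℝ, 0 < K ∧
      ∀ (d : ℕ) (V : Set (EuclideanSpace ℝ (Fin d)))
        (Y : Type*) [MeasurableSpace Y]
        (Θ : Type*) [MeasurableSpace Θ]
        (Ω : Type*) [MeasurableSpace Ω] (μ : Measure Ω) [IsProbabilityMeasure μ]
        (P : Measure (EuclideanSpace ℝ (Fin d) × Y)) [IsProbabilityMeasure P]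
        (n : ℕ) (_ : 2 ≤ n)
        (Z : Fin n → Ω → EuclideanSpace ℝ (Fin d) × Y)
        (_ : ∀ i, Measurable (Z i)) (_ : ∀ i, μ.map (Z i) = P) (_ : iIndepFun Z μ)
        (T : Ω → Θ) (_ : Measurable T) (_ : IndepFun T (fun ω i => Z i ω) μ)
        (s : Θ → EuclideanSpace ℝ (Fin d) → Y → ℝ) (q : Θ → EuclideanSpace ℝ (Fin d) → ℝ)
        (_ : MeasurableSet {w : Θ × (EuclideanSpace ℝ (Fin d) × Y) |
          w.2.2 ∈ thresholdSet (s w.1) (q w.1) w.2.1})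
        (δ : ℝ) (_ : 0 < δ) (_ : δ ≤ 1) (t : ℝ) (_ : 0 < t),
        VC V ≤ (d : ℕ∞) ∧ ((VC V).toNat : ℝ) ≤ minDimLogCard V ∧
        μ {ω | ¬ ∀ v ∈ V, ∀ a b : ℝ, a ≤ b →
            δ ≤ slabMass (empiricalDist fun i => Z i ω) (slab v a b) →
            |condCoverage (empiricalDist fun i => Z i ω)
                  (thresholdSet (s (T ω)) (q (T ω))) (slab v a b)
                - condCoverage P (thresholdSet (s (T ω)) (q (T ω))) (slab v a b)|
              ≤ K * Real.sqrt ((max 1 ((VC V).toNat : ℝ) * Real.log n + t) / (δ * n))}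
          ≤ ENNReal.ofReal (Real.exp (-t)) ∧
        K * Real.sqrt ((max 1 ((VC V).toNat : ℝ) * Real.log n + t) / (δ * n))
          ≤ K * Real.sqrt ((max 1 (minDimLogCard V) * Real.log n + t) / (δ * n)) := by
  refine ⟨36, by norm_num, ?_⟩
  intro d V Y _ Θ _ Ω _ μ _ P _ n hn Z hZ hlaw hindep T hT hTZ s q hsq δ hδ _ t ht
  have toNat_VC_le := toNat_VC_le_minDimLogCard V
  refine ⟨VC_le_dim V, toNat_VC_le, ?_, by gcongr⟩
  have := Measure.isProbabilityMeasure_map (μ := μ) hT.aemeasurable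
  have deviation_le := measure_prod_slabs_condCoverage_deviation_le V (μ.map T) P hn
    (C := fun θ => thresholdSet (s θ) (q θ)) hsq hδ ht.le
  rw [← map_prodMk_eq_prod_pi hZ hlaw hindep hT hTZ] at deviation_le
  refine (measure_mono ?_).trans ((Measure.le_map_apply
    (hT.prodMk (measurable_pi_lambda _ hZ)).aemeasurable _).trans deviation_le)
  exact fun ω hω hdev => hω fun v hv a b _ => hdev (slab v a b) ⟨v, hv, a, b, rfl⟩
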